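/- All graphs are finite and simple. A strong edge coloring of a graph $G$ is an edge coloring such that, for each edge $uv$, the color of $uv$ differs from the colors of all edges other than $uv$ that are incident with a vertex of $N_G(u)\cup N_G(v)$. The strong chromatic index $\chi_s'(G)$ is the minimum number of colors in a strong edge coloring of $G$, and $\Delta(G)$ is the maximum degree of $G$. A graph is $2$-connected if it has at least three vertices, is connected, and remains connected after the deletion of any one vertex; a $2$-connected graph $G$ is minimally $2$-connected if $G-e$ is not $2$-connected for each edge $e$ of $G$. Corollary 2. If $G$ is a minimally $2$-connected graph, then $\chi_s'(G)\le 4\Delta(G)-3$. -/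

import Mathlib

namespace SimpleGraph

/-- An edge coloring `C` is strong if for each edge `uv`, the color of `uv` is distinct from the
colors of the edges other than `uv` that are incident with a vertex of `N(u) ∪ N(v)`. (As `u` and
`v` belong to `N(u) ∪ N(v)`, the edges sharing an end with `uv` are among those.) -/
def EdgeLabeling.IsStrong {V K : Type*} {G : SimpleGraph V} (C : G.EdgeLabeling K) : Prop :=
  ∀ (u v : V) (huv : G.Adj u v), ∀ w ∈ G.neighborSet u ∪ G.neighborSet v,
    ∀ (x : V) (hwx : G.Adj w x), s(w, x) ≠ s(u, v) → C.get w x hwx ≠ C.get u v huv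

/-- `G` has a strong edge coloring with (at most) `n` colors. -/
def StrongEdgeColorable {V : Type*} (G : SimpleGraph V) (n : ℕ) : Prop :=
  ∃ C : G.EdgeLabeling (Fin n), C.IsStrong

/-- The strong chromatic index: the minimum number of colors in a strong edge coloring, with
value `⊤` if no finite number of colors suffices. -/
noncomputable def strongChromaticIndex {V : Type*} (G : SimpleGraph V) : ℕ∞ :=
  ⨅ n ∈ {n : ℕ | G.StrongEdgeColorable n}, (n : ℕ∞)

/-- A finite graph is 2-connected if it has at least three vertices, is connected, and stays
connected after the deletion of any one vertex. -/
def IsTwoConnected {V : Type*} [Fintype V] (G : SimpleGraph V) : Prop :=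
  3 ≤ Fintype.card V ∧ G.Connected ∧ ∀ v : V, (G.induce {v}ᶜ).Connected

/-- A 2-connected graph `G` is minimally 2-connected if `G - e` is not 2-connected for each
edge `e` of `G`. -/
def IsMinimallyTwoConnected {V : Type*} [Fintype V] (G : SimpleGraph V) : Prop :=
  G.IsTwoConnected ∧ ∀ e ∈ G.edgeSet, ¬ (G.deleteEdges {e}).IsTwoConnected

end SimpleGraph

/-! The vertices of degree at least three induce a forest
(`IsMinimallyTwoConnected.eq_empty_of_two_neighbors`): deleting an edge of a minimally 2-connected
graph creates a cut vertex, and along a cycle of such vertices the side cut off would shrink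
forever.

With D the maximum degree, the forest property lets one peel off edges in stars. In the remaining
graph H, some v has a neighbor of H-degree at most two and at most one neighbor of larger H-degree;
remove the edges from v to the former. Every vertex touched keeps at most one edge (`IsPeeling`).
Coloring greedily in reverse works, since a removed edge conflicts with at most D + (3D - 4) edges
of H. -/

namespace SimpleGraph

/-! ### Cut vertices created by deleting an edge -/

variable {V : Type*}

theorem Preconnected.exists_adj_of_mem_of_notMem {G : SimpleGraph V} (hG : G.Preconnected)
    {T : Set V} {a b : V} (ha : a ∈ T) (hb : b ∉ T) : ∃ c ∈ T, ∃ d ∉ T, G.Adj c d := by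
  obtain ⟨p⟩ := hG a b
  obtain ⟨d, -, h1, h2⟩ := p.exists_boundary_dart T ha hb
  exact ⟨d.fst, h1, d.snd, h2, d.adj⟩

theorem exists_closed_of_not_preconnected {G : SimpleGraph V} (hG : ¬ G.Preconnected) :
    ∃ T : Set V, (∃ a, a ∈ T) ∧ (∃ b, b ∉ T) ∧ ∀ c ∈ T, ∀ d, G.Adj c d → d ∈ T := by
  simp only [Preconnected, not_forall] at hG
  obtain ⟨a, b, hab⟩ := hG
  exact ⟨{c | G.Reachable a c}, ⟨a, Reachable.refl a⟩, ⟨b, hab⟩,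
    fun c hc d hcd => Reachable.trans hc hcd.reachable⟩

/-- In a 2-connected graph, some edge avoiding `v` leaves a nonempty vertex set that misses `v` and
another vertex. -/
theorem IsTwoConnected.exists_adj_ne [Fintype V] {G : SimpleGraph V} (hG : G.IsTwoConnected)
    {T : Set V} {v a b : V} (hv : v ∉ T) (ha : a ∈ T) (hb : b ∉ T) (hbv : b ≠ v) :
    ∃ c ∈ T, ∃ d ∉ T, d ≠ v ∧ G.Adj c d := by
  have hav : a ≠ v := fun h => hv (h ▸ ha)
  obtain ⟨c, hc, d, hd, hcd⟩ := (hG.2.2 v).preconnected.exists_adj_of_mem_of_notMem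
    (T := {x | (x : V) ∈ T}) (a := ⟨a, hav⟩) (b := ⟨b, hbv⟩) ha hb
  exact ⟨c, hc, d, hd, d.2, hcd⟩

/-- The vertex `z` separates `A` from its complement in `G - xy`, where `x ∈ A` and `y ∉ A`. -/
structure IsEdgeVertexSeparation (G : SimpleGraph V) (x y z : V) (A : Set V) : Prop where
  left_mem : x ∈ A
  right_notMem : y ∉ A
  right_ne : y ≠ z
  vertex_notMem : z ∉ A
  eq_of_adj : ∀ a ∈ A, ∀ b ∉ A, b ≠ z → G.Adj a b → a = x ∧ b = y

/-- If the edge were a bridge, its end on the side of a third vertex would be a cut vertex of `G`.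
-/
theorem IsTwoConnected.connected_deleteEdges [Fintype V] {G : SimpleGraph V}
    (hG : G.IsTwoConnected) {x y : V} (hxy : G.Adj x y) :
    (G.deleteEdges {s(x, y)}).Connected := by
  have : Nonempty V := ⟨x⟩
  refine ⟨?_⟩
  by_contra hcon
  obtain ⟨T, ⟨a, ha⟩, ⟨b, hb⟩, hT⟩ := exists_closed_of_not_preconnected hcon
  obtain ⟨w, hwx, hwy⟩ : ∃ w, w ≠ x ∧ w ≠ y := by
    classical
    obtain ⟨w, hw⟩ := Finset.exists_mem_notMem_of_card_lt_card (s := {x, y}) (t := Finset.univ)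
      ((Finset.card_le_two).trans_lt (by rw [Finset.card_univ]; exact hG.1))
    simp only [Finset.mem_univ, Finset.mem_insert, Finset.mem_singleton, not_or] at hw
    exact ⟨w, hw.2.1, hw.2.2⟩
  have hcross : ∀ c ∈ T, ∀ d ∉ T, G.Adj c d → (c = x ∧ d = y) ∨ (c = y ∧ d = x) := by
    intro c hc d hd hcd
    by_contra h
    refine hd (hT c hc d ?_)
    rw [deleteEdges_adj, Set.mem_singleton_iff, Sym2.eq_iff]
    exact ⟨hcd, h⟩
  obtain ⟨c, hc, d, hd, hcd⟩ := hG.2.1.preconnected.exists_adj_of_mem_of_notMem ha hb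
  have hcd' : c ≠ w ∧ d ≠ w := by
    rcases hcross c hc d hd hcd with ⟨rfl, rfl⟩ | ⟨rfl, rfl⟩
    · exact ⟨hwx.symm, hwy.symm⟩
    · exact ⟨hwy.symm, hwx.symm⟩
  by_cases hw : w ∈ T
  · obtain ⟨p, hp, q, hq, hqc, hpq⟩ := hG.exists_adj_ne (T := T \ {c}) (v := c) (a := w) (b := d)
      (by simp) ⟨hw, hcd'.1.symm⟩ (fun h => hd h.1) hcd.ne'
    have hq' : q ∉ T := fun h => hq ⟨h, hqc⟩
    have h1 := hcross p hp.1 q hq' hpq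
    have h2 := hcross c hc d hd hcd
    have h3 : p ≠ c := hp.2
    have := hxy.ne
    grind
  · obtain ⟨p, hp, q, hq, hqc, hpq⟩ := hG.exists_adj_ne (T := T) (v := d) (a := c) (b := w)
      hd hc hw hcd'.2.symm
    have h1 := hcross p hp q hq hpq
    have h2 := hcross c hc d hd hcd
    have := hxy.ne
    grind

/-- As `G - xy` is connected, it fails 2-connectivity through a cut vertex `z`. As `G - z` is
connected, `xy` is the only edge of `G - z` between the two sides; `A` is the side of `x`. -/
theorem IsMinimallyTwoConnected.exists_separation [Fintype V] {G : SimpleGraph V}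
    (hG : G.IsMinimallyTwoConnected) {x y : V} (hxy : G.Adj x y) :
    ∃ z A, G.IsEdgeVertexSeparation x y z A := by
  have hnot := hG.2 s(x, y) hxy
  simp only [IsTwoConnected, not_and, not_forall] at hnot
  obtain ⟨z, hz⟩ := hnot hG.1.1 (hG.1.connected_deleteEdges hxy)
  have hne := (hG.1.2.2 z).nonempty
  have hpre : ¬ ((G.deleteEdges {s(x, y)}).induce {z}ᶜ).Preconnected := fun h => hz ⟨h⟩
  obtain ⟨T, ⟨a, ha⟩, ⟨b, hb⟩, hT⟩ := exists_closed_of_not_preconnected hpre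
  have hcross : ∀ c ∈ T, ∀ d ∉ T, G.Adj c d →
      ((c : V) = x ∧ (d : V) = y) ∨ ((c : V) = y ∧ (d : V) = x) := by
    intro c hc d hd hcd
    by_contra h
    refine hd (hT c hc d ?_)
    rw [comap_adj, deleteEdges_adj, Set.mem_singleton_iff]
    refine ⟨hcd, fun h' => h (Sym2.eq_iff.1 h')⟩
  obtain ⟨c, hc, d, hd, hcd⟩ := (hG.1.2.2 z).preconnected.exists_adj_of_mem_of_notMem ha hb
  rcases hcross c hc d hd hcd with ⟨hcx, hdy⟩ | ⟨hcy, hdx⟩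
  · refine ⟨z, (↑) '' T, ⟨⟨c, hc, hcx⟩, ?_, hdy ▸ d.2, ?_, ?_⟩⟩
    · rintro ⟨d', hd', h⟩
      exact hd (Subtype.ext (h.trans hdy.symm) ▸ hd')
    · rintro ⟨d', -, h⟩
      exact d'.2 h
    · rintro _ ⟨p, hp, rfl⟩ q hq hqz hpq
      have hqT : (⟨q, hqz⟩ : ({z}ᶜ : Set V)) ∉ T := fun h => hq ⟨_, h, rfl⟩
      rcases hcross p hp ⟨q, hqz⟩ hqT hpq with h | ⟨h, -⟩
      · exact h
      · exact (hd (Subtype.ext (h.trans hdy.symm) ▸ hp)).elim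
  · refine ⟨z, (↑) '' Tᶜ, ⟨⟨d, hd, hdx⟩, ?_, hcy ▸ c.2, ?_, ?_⟩⟩
    · rintro ⟨d', hd', h⟩
      exact hd' (Subtype.ext (h.trans hcy.symm) ▸ hc)
    · rintro ⟨d', -, h⟩
      exact d'.2 h
    · rintro _ ⟨p, hp, rfl⟩ q hq hqz hpq
      have hqT : (⟨q, hqz⟩ : ({z}ᶜ : Set V)) ∈ T := by
        by_contra h
        exact hq ⟨_, h, rfl⟩
      rcases hcross ⟨q, hqz⟩ hqT p hp hpq.symm with ⟨-, h⟩ | ⟨h, h'⟩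
      · exact (hp (Subtype.ext (h.trans hcy.symm) ▸ hc)).elim
      · exact ⟨h', h⟩

/-! ### Vertices of degree at least three -/

/-- In a minimally 2-connected graph, the vertices of degree at least three induce a forest. -/
theorem IsMinimallyTwoConnected.eq_empty_of_two_neighbors [Fintype V] {G : SimpleGraph V}
    (hG : G.IsMinimallyTwoConnected) {S : Set V}
    (hS : ∀ x ∈ S, ∀ y, ∃ x' ∈ S, x' ≠ y ∧ G.Adj x x')
    (hdeg : ∀ x ∈ S, ∀ y y', ∃ w, w ≠ y ∧ w ≠ y' ∧ G.Adj x w) : S = ∅ := by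
  -- Descent on the size of `A`: continue from `xy` to an edge `xx'` inside `S`, and uncross `A`
  -- with the side `A'` of `x'`. Every position of `z` and `z'` but one makes `x` a cut vertex; in
  -- the last, `A ∩ A'` is a smaller side for `x'x`.
  have hmain : ∀ n : ℕ, ∀ x ∈ S, ∀ y ∈ S, ∀ z A, G.Adj x y → G.IsEdgeVertexSeparation x y z A →
      A.ncard = n → False := by
    intro n
    induction n using Nat.strong_induction_on with
    | _ n ih =>
    intro x hx y hy z A hxy hA hn
    obtain ⟨x', hx', hx'y, hxx'⟩ := hS x hx y
    obtain ⟨z', A', hA'⟩ := hG.exists_separation hxx'.symm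
    obtain ⟨w, hwy, hwx', hxw⟩ := hdeg x hx y x'
    obtain ⟨h1, h2, h3, h4, h5⟩ := hA
    obtain ⟨k1, k2, k3, k4, k5⟩ := hA'
    have hyA' : y ∉ A' := fun h => hx'y (k5 y h x k2 k3 hxy.symm).1.symm
    have hxz : x ≠ z := fun h => h4 (h ▸ h1)
    have hx'z' : x' ≠ z' := fun h => k4 (h ▸ k1)
    by_cases hz'B : z' ∉ A ∧ z' ≠ z
    · by_cases hzA' : z ∈ A'
      -- The third neighbor `w` of `x` keeps this set nonempty.
      · obtain ⟨p, hp, q, hq, hqx, hpq⟩ := hG.1.exists_adj_ne (T := (A \ A') \ {x}) (v := x)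
          (a := w) (b := y) (by simp) (by
            refine ⟨⟨?_, fun h => ?_⟩, hxw.ne'⟩
            · by_contra hwA
              by_cases hwz : w = z
              · subst hwz
                exact hwx' (k5 w hzA' x k2 k3 hxw.symm).1
              · exact hwy (h5 x h1 w hwA hwz hxw).2
            · exact hwx' (k5 w h x k2 k3 hxw.symm).1) (fun h => h2 h.1.1) hxy.ne'
        obtain ⟨⟨hpA, hpA'⟩, hpx⟩ := hp
        have hpx : p ≠ x := hpx
        have hpz' : p ≠ z' := fun h => hz'B.1 (h ▸ hpA)
        by_cases hqA' : q ∈ A'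
        · exact hpx (k5 q hqA' p hpA' hpz' hpq.symm).2
        · have hqA : q ∉ A := fun h => hq ⟨⟨h, hqA'⟩, hqx⟩
          have hqz : q ≠ z := fun h => hqA' (h ▸ hzA')
          exact hpx (h5 p hpA q hqA hqz hpq).1
      · have hx'A : x' ∈ A := by
          by_contra h
          by_cases hx'z : x' = z
          · exact hzA' (hx'z ▸ k1)
          · exact hx'y (h5 x h1 x' h hx'z hxx').2
        obtain ⟨p, hp, q, hq, hqx, hpq⟩ := hG.1.exists_adj_ne (T := A ∩ A') (v := x)
          (a := x') (b := y) (fun h => k2 h.2) ⟨hx'A, k1⟩ (fun h => h2 h.1) hxy.ne'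
        by_cases hqA : q ∈ A
        · have hqA' : q ∉ A' := fun h => hq ⟨hqA, h⟩
          exact hqx (k5 p hp.2 q hqA' (fun h => hz'B.1 (h ▸ hqA)) hpq).2
        · by_cases hqz : q = z
          · subst hqz
            exact hqx (k5 p hp.2 q hzA' (Ne.symm hz'B.2) hpq).2
          · have := (h5 p hp.1 q hqA hqz hpq).1
            exact k2 (this ▸ hp.2)
    · have hz' : z' ∈ A ∨ z' = z := by tauto
      by_cases hzA' : z ∈ A'
      · have hz'A : z' ∈ A := hz'.resolve_right fun h => k4 (h ▸ hzA')
        obtain ⟨p, hp, q, hq, hqx, hpq⟩ := hG.1.exists_adj_ne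
          (T := {v | v ∉ A ∧ v ∉ A'}) (v := x) (a := y) (b := z) (fun h => h.1 h1)
          ⟨h2, hyA'⟩ (fun h => h.2 hzA') hxz.symm
        have hpz : p ≠ z := fun h => hp.2 (h ▸ hzA')
        have hpz' : p ≠ z' := fun h => hp.1 (h ▸ hz'A)
        by_cases hqA : q ∈ A
        · exact hqx (h5 q hqA p hp.1 hpz hpq.symm).1
        · have hqA' : q ∈ A' := by
            by_contra h
            exact hq ⟨hqA, h⟩
          exact hp.1 ((k5 q hqA' p hp.2 hpz' hpq.symm).2 ▸ h1)
      · have hx'A : x' ∈ A := by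
          by_contra h
          by_cases hx'z : x' = z
          · exact hzA' (hx'z ▸ k1)
          · exact hx'y (h5 x h1 x' h hx'z hxx').2
        refine ih (A ∩ A').ncard (hn ▸ Set.ncard_lt_ncard ?_ A.toFinite) x' hx' x hx z' (A ∩ A')
          hxx'.symm ⟨⟨hx'A, k1⟩, fun h => k2 h.2, k3, fun h => k4 h.2, ?_⟩ rfl
        · exact ⟨Set.inter_subset_left, fun h => k2 (h h1).2⟩
        · intro a ha b hb hbz' hab
          refine k5 a ha.2 b (fun hbA' => ?_) hbz' hab
          have hbA : b ∉ A := fun h => hb ⟨h, hbA'⟩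
          by_cases hbz : b = z
          · exact hzA' (hbz ▸ hbA')
          · exact k2 ((h5 a ha.1 b hbA hbz hab).1 ▸ ha.2)
  by_contra hne
  obtain ⟨x, hx⟩ := Set.nonempty_iff_ne_empty.2 hne
  obtain ⟨y, hy, -, hxy⟩ := hS x hx x
  obtain ⟨z, A, hA⟩ := hG.exists_separation hxy
  exact hmain _ x hx y hy z A hxy hA rfl

open scoped Classical in
theorem IsTwoConnected.two_le_degree [Fintype V] {G : SimpleGraph V} (hG : G.IsTwoConnected)
    (v : V) : 2 ≤ G.degree v := by
  obtain ⟨u, huv⟩ : ∃ u, u ≠ v := by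
    have : Nontrivial V := Fintype.one_lt_card_iff_nontrivial.1 (by have := hG.1; omega)
    exact exists_ne v
  obtain ⟨c, rfl, x, -, hvx⟩ := hG.2.1.preconnected.exists_adj_of_mem_of_notMem
    (T := {v}) (a := v) (b := u) rfl huv
  obtain ⟨w, hw⟩ := Finset.exists_mem_notMem_of_card_lt_card (s := {c, x}) (t := Finset.univ)
    ((Finset.card_le_two).trans_lt (by rw [Finset.card_univ]; exact hG.1))
  simp only [Finset.mem_univ, Finset.mem_insert, Finset.mem_singleton, not_or] at hw
  obtain ⟨c', rfl, y, -, hyx, hcy⟩ := hG.exists_adj_ne (T := {c}) (v := x) (a := c) (b := w)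
    hvx.ne' rfl hw.2.1 hw.2.2
  rw [← card_neighborFinset_eq_degree]
  exact Finset.one_lt_card.2 ⟨x, by simpa using hvx, y, by simpa using hcy, hyx.symm⟩

/-! ### Greedy coloring and counting conflicts -/

/-- Some end of `e` is adjacent to some end of `e'`. -/
def EdgesConflict (G : SimpleGraph V) (e e' : Sym2 V) : Prop :=
  ∃ a ∈ e, ∃ b ∈ e', G.Adj a b

theorem EdgesConflict.symm {G : SimpleGraph V} {e e' : Sym2 V} (h : G.EdgesConflict e e') :
    G.EdgesConflict e' e := by
  obtain ⟨a, ha, b, hb, hab⟩ := h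
  exact ⟨b, hb, a, ha, hab.symm⟩

-- Conflicts are counted against all of `s ∪ t`, so the elements of `t` can be colored in any order.
open scoped Classical in
theorem exists_greedy_extension {E : Type*} [DecidableEq E] {R : E → E → Prop}
    (hR : ∀ e e', R e e' → R e' e)
    {n : ℕ} {s t : Finset E} {f : E → Fin n}
    (hf : ∀ e ∈ s, ∀ e' ∈ s, e ≠ e' → R e e' → f e ≠ f e')
    (hcard : ∀ e ∈ t, {e' ∈ s ∪ t | e' ≠ e ∧ R e e'}.card < n) :
    ∃ g : E → Fin n, ∀ e ∈ s ∪ t, ∀ e' ∈ s ∪ t, e ≠ e' → R e e' → g e ≠ g e' := by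
  suffices h : ∀ r ⊆ t, ∃ g : E → Fin n,
      ∀ e ∈ s ∪ r, ∀ e' ∈ s ∪ r, e ≠ e' → R e e' → g e ≠ g e' from h t subset_rfl
  intro r
  induction r using Finset.induction_on with
  | empty => exact fun _ => ⟨f, by simpa using hf⟩
  | insert a r _ ih =>
    intro hr
    obtain ⟨g, hg⟩ := ih ((Finset.subset_insert a r).trans hr)
    have hlt : (({e' ∈ s ∪ t | e' ≠ a ∧ R a e'}).image g).card <
        (Finset.univ : Finset (Fin n)).card := by
      rw [Finset.card_fin]
      exact Finset.card_image_le.trans_lt (hcard a (hr (Finset.mem_insert_self a r)))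
    obtain ⟨c, -, hc⟩ := Finset.exists_mem_notMem_of_card_lt_card hlt
    have hfresh : ∀ e ∈ s ∪ insert a r, e ≠ a → R a e → g e ≠ c := by
      intro e he hea hae hgc
      refine hc (Finset.mem_image.2 ⟨e, Finset.mem_filter.2 ⟨?_, hea, hae⟩, hgc⟩)
      exact Finset.union_subset_union_right hr he
    have hold : ∀ e ∈ s ∪ insert a r, e ≠ a → e ∈ s ∪ r := by
      intro e he hea
      simp only [Finset.mem_union, Finset.mem_insert] at he ⊢
      tauto
    refine ⟨Function.update g a c, fun e he e' he' hne hee' => ?_⟩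
    by_cases hea : e = a
    · subst hea
      rw [Function.update_self, Function.update_of_ne hne.symm]
      exact (hfresh e' he' hne.symm hee').symm
    · rw [Function.update_of_ne hea]
      by_cases he'a : e' = a
      · subst he'a
        rw [Function.update_self]
        exact hfresh e he hea (hR _ _ hee')
      · rw [Function.update_of_ne he'a]
        exact hg e (hold e he hea) e' (hold e' he' he'a) hne hee'

open scoped Classical in
theorem card_conflicts_le [Fintype V] {G H : SimpleGraph V} (hHG : H ≤ G) (u v : V) :
    {e ∈ H.edgeFinset | e ≠ s(v, u) ∧ G.EdgesConflict s(v, u) e}.card ≤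
      ∑ b ∈ (G.neighborFinset u).erase v, H.degree b +
        ∑ b ∈ (G.neighborFinset v).erase u, H.degree b := by
  have hsub : {e ∈ H.edgeFinset | e ≠ s(v, u) ∧ G.EdgesConflict s(v, u) e} ⊆
      ((G.neighborFinset u).erase v).biUnion (fun b => H.incidenceFinset b) ∪
        ((G.neighborFinset v).erase u).biUnion (fun b => H.incidenceFinset b) := by
    intro e he
    rw [Finset.mem_filter, mem_edgeFinset] at he
    obtain ⟨he, hne, a, ha, b, hb, hab⟩ := he
    obtain ⟨c, rfl⟩ := Sym2.mem_iff_exists.1 hb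
    have hbc : H.Adj b c := he
    have hbc' := hHG hbc
    simp only [Finset.mem_union, Finset.mem_biUnion, Finset.mem_erase, mem_neighborFinset,
      mem_incidenceFinset, incidenceSet, Set.mem_sep_iff, mem_edgeSet]
    have hb' : b ∈ s(b, c) := Sym2.mem_mk_left b c
    have hc' : c ∈ s(b, c) := Sym2.mem_mk_right b c
    rw [Sym2.mem_iff] at ha
    have hne1 : ¬ (b = v ∧ c = u) := fun h => hne (by rw [h.1, h.2])
    have hne2 : ¬ (b = u ∧ c = v) := fun h => hne (by rw [h.1, h.2, Sym2.eq_swap])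
    rcases ha with rfl | rfl
    -- An edge at `u` or `v` itself is counted at its other end.
    · by_cases hbu : b = u
      · subst hbu
        exact .inl ⟨c, ⟨fun h => hne2 ⟨rfl, h⟩, hbc'⟩, hbc, hc'⟩
      · exact .inr ⟨b, ⟨hbu, hab⟩, hbc, hb'⟩
    · by_cases hbv : b = v
      · subst hbv
        exact .inr ⟨c, ⟨fun h => hne1 ⟨rfl, h⟩, hbc'⟩, hbc, hc'⟩
      · exact .inl ⟨b, ⟨hbv, hab⟩, hbc, hb'⟩
  refine (Finset.card_le_card hsub).trans ((Finset.card_union_le _ _).trans ?_)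
  refine Nat.add_le_add (Finset.card_biUnion_le.trans ?_) (Finset.card_biUnion_le.trans ?_) <;>
  · refine Finset.sum_le_sum fun b _ => ?_
    rw [card_incidenceFinset_eq_degree]

/-! ### Peeling off stars -/

/-- Every vertex of the subgraph `H` of `G` has all its `G`-neighbors in `H`, or at most one. -/
def IsPeeling (G H : SimpleGraph V) : Prop :=
  ∀ v, (∀ a b, H.Adj v a → H.Adj v b → a = b) ∨ ∀ w, G.Adj v w → H.Adj v w

open scoped Classical in
theorem degree_le_one_of_subsingleton [Fintype V] {H : SimpleGraph V} {v : V}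
    (h : ∀ a b, H.Adj v a → H.Adj v b → a = b) : H.degree v ≤ 1 := by
  rw [← card_neighborFinset_eq_degree, Finset.card_le_one]
  intro a ha b hb
  exact h a b (by simpa using ha) (by simpa using hb)

-- Any other `G`-neighbor of `u` has lost its edge to `u`, so by peeling it retains at most one
-- edge.
open scoped Classical in
theorem IsPeeling.sum_degree_le_of_subsingleton [Fintype V] {G H : SimpleGraph V}
    (hp : G.IsPeeling H) {u v : V} (hvu : H.Adj u v) (hHG : H ≤ G)
    (h : ∀ a b, H.Adj u a → H.Adj u b → a = b) :
    ∑ b ∈ (G.neighborFinset u).erase v, H.degree b ≤ G.degree u - 1 := by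
  rw [← card_neighborFinset_eq_degree, ← Finset.card_erase_of_mem (a := v)
    (by simpa using hHG hvu), Finset.card_eq_sum_ones]
  refine Finset.sum_le_sum fun b hb => ?_
  rw [Finset.mem_erase, mem_neighborFinset] at hb
  rcases hp b with hb1 | hb1
  · exact degree_le_one_of_subsingleton hb1
  · exact (hb.1 (h b v (hb1 u hb.2.symm).symm hvu)).elim

open scoped Classical in
theorem IsPeeling.card_conflicts_lt [Fintype V] {G H : SimpleGraph V} (hp : G.IsPeeling H)
    (hHG : H ≤ G) {D : ℕ} (hD2 : 2 ≤ D) (hD : ∀ v, G.degree v ≤ D) {u v : V} (hvu : H.Adj v u)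
    (hu : H.degree u ≤ 2)
    (hv : ∀ a b, H.Adj v a → H.Adj v b → 2 < H.degree a → 2 < H.degree b → a = b) :
    {e ∈ H.edgeFinset | e ≠ s(v, u) ∧ G.EdgesConflict s(v, u) e}.card < 4 * D - 3 := by
  have hHD : ∀ b, H.degree b ≤ D := fun b => (degree_le_of_le hHG).trans (hD b)
  have hsumu : ∑ b ∈ (G.neighborFinset u).erase v, H.degree b ≤ D := by
    rcases hp u with h | h
    · exact (hp.sum_degree_le_of_subsingleton hvu.symm hHG h).trans (by have := hD u; omega)
    · have hc : ((G.neighborFinset u).erase v).card ≤ 1 := by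
        rw [Finset.card_erase_of_mem (by simpa using (hHG hvu).symm)]
        have : G.neighborFinset u = H.neighborFinset u := by
          ext w
          simpa using ⟨fun hw => h w hw, fun hw => hHG hw⟩
        rw [this, card_neighborFinset_eq_degree]
        omega
      calc _ ≤ ((G.neighborFinset u).erase v).card • D :=
            Finset.sum_le_card_nsmul _ _ _ fun b _ => hHD b
        _ ≤ 1 • D := Nat.mul_le_mul_right D hc
        _ = D := one_nsmul D
  -- At most `D - 1` terms, each at most 2 except for one possible excess of `D - 2`.
  have hsumv : ∑ b ∈ (G.neighborFinset v).erase u, H.degree b ≤ 3 * D - 4 := by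
    rcases hp v with h | h
    · exact (hp.sum_degree_le_of_subsingleton hvu hHG h).trans (by have := hD v; omega)
    · set N := (G.neighborFinset v).erase u with hN
      have hcN : N.card ≤ D - 1 := by
        rw [Finset.card_erase_of_mem (by simpa using hHG hvu), card_neighborFinset_eq_degree]
        exact Nat.sub_le_sub_right (hD v) 1
      have hbig : {b ∈ N | 2 < H.degree b}.card ≤ 1 := by
        rw [Finset.card_le_one]
        intro a ha b hb
        simp only [hN, Finset.mem_filter, Finset.mem_erase, mem_neighborFinset] at ha hb
        exact hv a b (h a ha.1.2) (h b hb.1.2) ha.2 hb.2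
      have hle : ∀ b ∈ N, H.degree b ≤ 2 + if 2 < H.degree b then D - 2 else 0 := by
        intro b _
        have := hHD b
        split_ifs <;> omega
      have := Finset.sum_le_sum hle
      rw [Finset.sum_add_distrib, Finset.sum_const, ← Finset.sum_filter, Finset.sum_const,
        smul_eq_mul, smul_eq_mul] at this
      have h2 := Nat.mul_le_mul_right (D - 2) hbig
      omega
  have := card_conflicts_le hHG u v
  omega

open scoped Classical in
/-- If no nonempty set of vertices of degree at least three induces a subgraph of minimum degree
at least two, then every nonempty subgraph has a vertex with a neighbor of degree at most two and
at most one neighbor of larger degree. -/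
theorem exists_peelable_vertex [Fintype V] {G H : SimpleGraph V} (hHG : H ≤ G)
    (hG : ∀ S : Set V, (∀ x ∈ S, ∀ y, ∃ x' ∈ S, x' ≠ y ∧ G.Adj x x') →
      (∀ x ∈ S, ∀ y y', ∃ w, w ≠ y ∧ w ≠ y' ∧ G.Adj x w) → S = ∅)
    (hne : ∃ a b, H.Adj a b) :
    ∃ v, (∃ u, H.Adj v u ∧ H.degree u ≤ 2) ∧
      ∀ a b, H.Adj v a → H.Adj v b → 2 < H.degree a → 2 < H.degree b → a = b := by
  have hthree : ∀ x, 2 < H.degree x → ∀ y y', ∃ w, w ≠ y ∧ w ≠ y' ∧ H.Adj x w := by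
    intro x hx y y'
    rw [← card_neighborFinset_eq_degree] at hx
    obtain ⟨w, hw, hw'⟩ := Finset.exists_mem_notMem_of_card_lt_card
      ((Finset.card_le_two (a := y) (b := y')).trans_lt hx)
    simp only [Finset.mem_insert, Finset.mem_singleton, not_or] at hw'
    exact ⟨w, hw'.1, hw'.2, by simpa using hw⟩
  by_contra hcon
  -- Without a suitable vertex, each vertex of this set has two neighbors in it, so the set is
  -- empty; but then any non-isolated vertex of `H` is suitable.
  have hS := hG {x | 2 < H.degree x} (fun x hx y => ?_) (fun x hx y y' => ?_)
  · obtain ⟨a, b, hab⟩ := hne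
    have hsmall : ∀ x, ¬ 2 < H.degree x := fun x hx =>
      Set.notMem_empty x (hS ▸ (show x ∈ {x | 2 < H.degree x} from hx))
    exact hcon ⟨a, ⟨b, hab, not_lt.1 (hsmall b)⟩, fun a _ _ _ h => (hsmall a h).elim⟩
  · by_contra hno
    have huniq : ∀ a, H.Adj x a → 2 < H.degree a → a = y := by
      intro a hxa ha
      by_contra hay
      exact hno ⟨a, ha, hay, hHG hxa⟩
    obtain ⟨u, huy, -, hxu⟩ := hthree x hx y y
    refine hcon ⟨x, ⟨u, hxu, not_lt.1 fun h => huy (huniq u hxu h)⟩, ?_⟩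
    intro a b ha hb ha2 hb2
    rw [huniq a ha ha2, huniq b hb hb2]
  · obtain ⟨w, h1, h2, h3⟩ := hthree x hx y y'
    exact ⟨w, h1, h2, hHG h3⟩

open scoped Classical in
theorem IsPeeling.exists_coloring [Fintype V] {G : SimpleGraph V}
    (hG : ∀ S : Set V, (∀ x ∈ S, ∀ y, ∃ x' ∈ S, x' ≠ y ∧ G.Adj x x') →
      (∀ x ∈ S, ∀ y y', ∃ w, w ≠ y ∧ w ≠ y' ∧ G.Adj x w) → S = ∅)
    {D : ℕ} (hD2 : 2 ≤ D) (hD : ∀ v, G.degree v ≤ D) (H : SimpleGraph V) (hHG : H ≤ G)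
    (hp : G.IsPeeling H) :
    ∃ f : Sym2 V → Fin (4 * D - 3), ∀ e ∈ H.edgeFinset, ∀ e' ∈ H.edgeFinset, e ≠ e' →
      G.EdgesConflict e e' → f e ≠ f e' := by
  induction hn : H.edgeFinset.card using Nat.strong_induction_on generalizing H with
  | _ n ih =>
  by_cases hne : ∃ a b, H.Adj a b
  · obtain ⟨v, ⟨u, hvu, hu⟩, hv⟩ := exists_peelable_vertex hHG hG hne
    let star : Set (Sym2 V) := {e | ∃ w, H.degree w ≤ 2 ∧ e = s(v, w)}
    obtain ⟨H', hH'_eq⟩ : ∃ H', H' = H.deleteEdges star := ⟨_, rfl⟩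
    have hH'adj : ∀ a b, H'.Adj a b ↔ H.Adj a b ∧ s(a, b) ∉ star := fun a b => by
      rw [hH'_eq, deleteEdges_adj]
    have hH' : H' ≤ H := hH'_eq ▸ deleteEdges_le star
    have hvu' : s(v, u) ∈ star := ⟨u, hu, rfl⟩
    have hlt : H'.edgeFinset.card < n := by
      rw [← hn]
      refine Finset.card_lt_card (edgeFinset_ssubset_edgeFinset.2 (lt_of_le_of_ne hH' ?_))
      intro h
      exact ((hH'adj v u).1 (h ▸ hvu)).2 hvu'
    -- `v` keeps at most its one edge to a vertex of large degree, the far ends of the star had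
    -- degree at most two and lose an edge, and other vertices lose nothing.
    have hp' : G.IsPeeling H' := by
      intro a
      by_cases hav : a = v
      · subst hav
        refine .inl fun b c hb hc => ?_
        rw [hH'adj] at hb hc
        exact hv b c hb.1 hc.1 (not_le.1 fun h => hb.2 ⟨b, h, rfl⟩)
          (not_le.1 fun h => hc.2 ⟨c, h, rfl⟩)
      · by_cases ha : H.Adj v a ∧ H.degree a ≤ 2
        · refine .inl fun b c hb hc => ?_
          rw [hH'adj] at hb hc
          by_contra hbc
          have hbv : b ≠ v := fun h => hb.2 ⟨a, ha.2, by rw [h, Sym2.eq_swap]⟩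
          have hcv : c ≠ v := fun h => hc.2 ⟨a, ha.2, by rw [h, Sym2.eq_swap]⟩
          have hthree : 2 < (H.neighborFinset a).card :=
            Finset.two_lt_card.2 ⟨b, by simpa using hb.1, c, by simpa using hc.1, v,
              by simpa using ha.1.symm, hbc, hbv, hcv⟩
          rw [card_neighborFinset_eq_degree] at hthree
          omega
        · have hsame : ∀ b, H.Adj a b → H'.Adj a b := by
            intro b hab
            refine (hH'adj a b).2 ⟨hab, ?_⟩
            rintro ⟨w, hw, h⟩
            rcases Sym2.eq_iff.1 h with ⟨h1, -⟩ | ⟨rfl, rfl⟩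
            · exact hav h1
            · exact ha ⟨hab.symm, hw⟩
          rcases hp a with h | h
          · exact .inl fun b c hb hc => h b c (hH' hb) (hH' hc)
          · exact .inr fun w hw => hsame w (h w hw)
    obtain ⟨f, hf⟩ := ih _ hlt H' (hH'.trans hHG) hp' rfl
    have hunion : H'.edgeFinset ∪ {e ∈ H.edgeFinset | e ∈ star} = H.edgeFinset := by
      ext e
      simp only [Finset.mem_union, Finset.mem_filter, mem_edgeFinset, hH'_eq, edgeSet_deleteEdges,
        Set.mem_sdiff]
      tauto
    obtain ⟨g, hg⟩ := exists_greedy_extension (R := G.EdgesConflict) (fun _ _ h => h.symm)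
      (t := {e ∈ H.edgeFinset | e ∈ star}) hf (by
        intro e he
        rw [hunion]
        rw [Finset.mem_filter, mem_edgeFinset] at he
        obtain ⟨he, w, hw, rfl⟩ := he
        exact hp.card_conflicts_lt hHG hD2 hD he hw hv)
    rw [hunion] at hg
    exact ⟨g, hg⟩
  · refine ⟨fun _ => ⟨0, by omega⟩, fun e he => ?_⟩
    induction e with
    | _ a b => exact (hne ⟨a, b, by simpa using he⟩).elim

theorem IsMinimallyTwoConnected.strongEdgeColorable [Fintype V] {G : SimpleGraph V}
    (hG : G.IsMinimallyTwoConnected) {D : ℕ} (hD2 : 2 ≤ D)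
    (hD : ∀ v, (G.neighborSet v).ncard ≤ D) : G.StrongEdgeColorable (4 * D - 3) := by
  classical
  obtain ⟨f, hf⟩ := IsPeeling.exists_coloring (G := G)
    (fun _ => hG.eq_empty_of_two_neighbors) hD2
    (fun v => by
      rw [← card_neighborSet_eq_degree, ← Nat.card_eq_fintype_card]
      exact hD v) G le_rfl
    (fun _ => .inr fun _ h => h)
  refine ⟨fun e => f e, fun u v huv w hw x hwx hne => ?_⟩
  refine hf s(w, x) (by simpa using hwx) s(u, v) (by simpa using huv) hne ?_
  rcases hw with hw | hw
  · exact ⟨w, Sym2.mem_mk_left w x, u, Sym2.mem_mk_left u v, hw.symm⟩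
  · exact ⟨w, Sym2.mem_mk_left w x, v, Sym2.mem_mk_right u v, hw.symm⟩

end SimpleGraph

theorem corollary2 {V : Type*} [Fintype V] (G : SimpleGraph V) [DecidableRel G.Adj]
    (hG : G.IsMinimallyTwoConnected) :
    G.strongChromaticIndex + 3 ≤ 4 * (G.maxDegree : ℕ∞) := by
  obtain ⟨v⟩ := hG.1.2.1.nonempty
  have h2 : 2 ≤ G.maxDegree := by
    refine le_trans ?_ (G.degree_le_maxDegree v)
    exact (hG.1.two_le_degree v).trans_eq (by congr!)
  have hcol := hG.strongEdgeColorable h2 fun w => by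
    refine le_trans (le_of_eq ?_) (G.degree_le_maxDegree w)
    rw [← SimpleGraph.card_neighborSet_eq_degree, ← Nat.card_eq_fintype_card]
    rfl
  calc G.strongChromaticIndex + 3 ≤ ((4 * G.maxDegree - 3 : ℕ) : ℕ∞) + 3 := by
        gcongr
        exact iInf₂_le _ hcol
    _ = ((4 * G.maxDegree - 3 + 3 : ℕ) : ℕ∞) := by push_cast; rfl
    _ = ((4 * G.maxDegree : ℕ) : ℕ∞) := by rw [Nat.sub_add_cancel (by omega)]
    _ = 4 * (G.maxDegree : ℕ∞) := by push_cast; rfl
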